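/- Let $\mathbb{H}^2$ be the hyperbolic plane, let $O\in\mathbb{H}^2$ be a fixed point (the origin), and let $K\subset\mathbb{H}^2$ be a convex body, that is, a compact, geodesically convex set that is the closure of its non-empty interior. Suppose that $O$ lies in the interior of $K$ and that the boundary $\partial K$ is a $C^1$-smooth curve, that is, the image of a simple closed $C^1$ curve with nowhere vanishing derivative. A geodesic (line) supports $K$ if it meets $K$ but not the interior of $K$. For $x\in\partial K$, let $n_K(x)$ be the geodesic through $x$ that is perpendicular to the supporting geodesic of $K$ at $x$, let $\Gamma_2$ be the other supporting geodesic of $K$ that is perpendicular to $n_K(x)$, let $\phi(x)$ be the point of intersection of $n_K(x)$ and $\Gamma_2$, and call the length $w_K(x)$ of the geodesic segment $[x,\phi(x)]$ the width of $K$ at $x$. Suppose that $K$ has constant width $w$, that is, $w_K(x)=w$ for all $x\in\partial K$. If there is a constant $c$ such that for every geodesic $\Gamma$ through $O$ the section $K\cap\Gamma$ is a geodesic segment of length $c$, then $K$ is a disc, that is, a closed hyperbolic ball of positive radius. -/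

import Mathlib

open scoped UpperHalfPlane

namespace HypPlane

/-- A geodesic line of the Poincaré upper half-plane: a vertical half-line with real end point `a`,
or the half-circle with real centre `a` and Euclidean radius `r > 0`. -/
inductive Geodesic where
  | vertical (a : ℝ) : Geodesic
  | semicircle (a r : ℝ) (hr : 0 < r) : Geodesic

/-- The set of points of a geodesic line. -/
def Geodesic.carrier : Geodesic → Set ℍ
  | .vertical a => {z | z.re = a}
  | .semicircle a r _ => {z | ‖(z : ℂ) - (a : ℂ)‖ = r}

/-- A (Euclidean) nonzero tangent vector, at a point `z` of the geodesic, to that geodesic. For the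
half-circle centred at `a` it is the radius vector `z - a` turned by a right angle. -/
noncomputable def Geodesic.tangent : Geodesic → ℍ → ℂ
  | .vertical _, _ => Complex.I
  | .semicircle a _ _, z => Complex.I * ((z : ℂ) - (a : ℂ))

/-- Two geodesic lines are perpendicular: they meet at a point where their tangents are orthogonal.
The half-plane model is conformal, so hyperbolic and Euclidean right angles agree. -/
def Geodesic.Perp (Γ₁ Γ₂ : Geodesic) : Prop :=
  ∃ z : ℍ, z ∈ Γ₁.carrier ∧ z ∈ Γ₂.carrier ∧ inner ℝ (Γ₁.tangent z) (Γ₂.tangent z) = 0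

/-- The geodesic segment `[x, y]`, for the hyperbolic distance of `ℍ`. -/
def seg (x y : ℍ) : Set ℍ := {z | dist x z + dist z y = dist x y}

/-- The set `S` is a geodesic segment (possibly a single point) of hyperbolic length `l`. -/
def HasLength (S : Set ℍ) (l : ℝ) : Prop :=
  ∃ x y : ℍ, S = seg x y ∧ dist x y = l

/-- A convex body: compact, equal to the closure of its nonempty interior, and containing the
geodesic segment between any two of its points. -/
structure IsConvexBody (K : Set ℍ) : Prop where
  isCompact : IsCompact K
  closure_interior : closure (interior K) = K
  interior_nonempty : (interior K).Nonempty
  seg_subset : ∀ x ∈ K, ∀ y ∈ K, seg x y ⊆ K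

/-- The boundary of `K` is a `C¹`-smooth curve: it is the image of a simple closed curve
(parametrized with period `1`) that is continuously differentiable with nowhere zero derivative. -/
def HasC1Boundary (K : Set ℍ) : Prop :=
  ∃ γ : ℝ → ℂ, ContDiff ℝ 1 γ ∧ (∀ t, deriv γ t ≠ 0) ∧
    (∀ s t, γ s = γ t ↔ ∃ n : ℤ, t = s + n) ∧
    Set.range γ = (fun z : ℍ => (z : ℂ)) '' frontier K

/-- The geodesic line `Γ` supports `K`: it meets `K` but not the interior of `K`. -/
def Supports (Γ : Geodesic) (K : Set ℍ) : Prop :=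
  (Γ.carrier ∩ K).Nonempty ∧ Γ.carrier ∩ interior K = ∅

/-- The body `K` has width `w` at its boundary point `x`. Here `N` is the normal geodesic at `x`,
that is, the perpendicular at `x` to a supporting geodesic `Γ₁` through `x`; `Γ₂` is another
supporting geodesic that is perpendicular to `N`; it meets `N` at `y`; and `w` is the length of
the segment `[x, y]`. -/
def HasWidthAt (K : Set ℍ) (x : ℍ) (w : ℝ) : Prop :=
  ∃ (Γ₁ N Γ₂ : Geodesic) (y : ℍ),
    Supports Γ₁ K ∧ x ∈ Γ₁.carrier ∧ x ∈ N.carrier ∧ Γ₁.Perp N ∧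
    Supports Γ₂ K ∧ Γ₂ ≠ Γ₁ ∧ Γ₂.Perp N ∧ y ∈ Γ₂.carrier ∧ y ∈ N.carrier ∧ dist x y = w

/-- The body `K` has constant width `w`. -/
def HasConstantWidth (K : Set ℍ) (w : ℝ) : Prop :=
  ∀ x ∈ frontier K, HasWidthAt K x w

/-- `K` is a (closed, nondegenerate) hyperbolic disc. -/
def IsDisc (K : Set ℍ) : Prop :=
  ∃ (p : ℍ) (r : ℝ), 0 < r ∧ K = Metric.closedBall p r

end HypPlane

namespace HypPlane

open Real

/-! ### Weierstrass coordinates -/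

/-! First, `w = c`. Let `q` be a point of `K` farthest from `O`, at distance `M`, and let `p` be the
other end of the chord through `q` and `O`. Each chord through `O` has length `c`, so the ball of
radius `c - M` about `O` lies in `K` and touches the boundary at `p`, while `K` lies in the ball of
radius `M`. Hence `K` lies between the perpendiculars to the chord at `p` and `q`, and `eq_of_width`
says that the width at `p` is `c` (`HasConstantWidth.eq_of_equichordal`).

Next, no two points of `K` are more than `w` apart. A diameter of `K` is again a chord with `K`
between its end perpendiculars; smoothness makes the supporting geodesic at its end unique, so its
length is the width there (`HasConstantWidth.dist_le`).

Finally, let the chord in direction `θ` run from `ρ θ - c` to `ρ θ`. Its far end and the near end of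
the chord in direction `φ` are at most `c` apart. This gives `ρ θ - ρ φ ≤ C (θ - φ) ^ 2`
(`sub_le_of_cosh_le`), so `ρ` has zero derivative and is constant.

All computations take place on the hyperboloid, where geodesics are zero sets of linear forms. -/

/-- The time coordinate of `z` in Weierstrass coordinates based at `p`. -/
noncomputable def wt (p z : ℍ) : ℝ :=
  ((z.re - p.re) ^ 2 + z.im ^ 2 + p.im ^ 2) / (2 * p.im * z.im)

/-- The horizontal coordinate of `z` in Weierstrass coordinates based at `p`. -/
noncomputable def wx (p z : ℍ) : ℝ := (z.re - p.re) / z.im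

/-- The vertical coordinate of `z` in Weierstrass coordinates based at `p`. -/
noncomputable def wy (p z : ℍ) : ℝ :=
  ((z.re - p.re) ^ 2 + z.im ^ 2 - p.im ^ 2) / (2 * p.im * z.im)

lemma wt_pos (p z : ℍ) : 0 < wt p z := by
  have := p.im_pos
  have := z.im_pos
  unfold wt
  positivity

lemma wt_sq (p z : ℍ) : wt p z ^ 2 = 1 + wx p z ^ 2 + wy p z ^ 2 := by
  have := p.im_pos.ne'
  have := z.im_pos.ne'
  unfold wt wx wy
  field_simp
  ring

lemma one_le_wt (p z : ℍ) : 1 ≤ wt p z := by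
  nlinarith [wt_sq p z, wt_pos p z, sq_nonneg (wx p z), sq_nonneg (wy p z)]

lemma cosh_dist_eq (p z w : ℍ) :
    cosh (dist z w) = wt p z * wt p w - wx p z * wx p w - wy p z * wy p w := by
  have := p.im_pos.ne'
  have := z.im_pos.ne'
  have := w.im_pos.ne'
  rw [UpperHalfPlane.cosh_dist']
  unfold wt wx wy
  field_simp
  ring

lemma wt_self (p : ℍ) : wt p p = 1 := by
  have := p.im_pos.ne'
  unfold wt
  field_simp
  ring

lemma wx_self (p : ℍ) : wx p p = 0 := by simp [wx]

lemma wy_self (p : ℍ) : wy p p = 0 := by simp [wy]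

lemma cosh_dist_base (p z : ℍ) : cosh (dist p z) = wt p z := by
  rw [cosh_dist_eq p, wt_self, wx_self, wy_self]
  ring

lemma eq_of_wx_eq_of_wy_eq {p z w : ℍ} (hx : wx p z = wx p w) (hy : wy p z = wy p w) :
    z = w := by
  have ht : wt p z = wt p w := by
    have h := wt_sq p z
    rw [hx, hy, ← wt_sq p w] at h
    exact (pow_left_inj₀ (wt_pos p z).le (wt_pos p w).le two_ne_zero).1 h
  have h : cosh (dist z w) = cosh 0 := by
    rw [cosh_dist_eq p, hx, hy, ht, cosh_zero]
    linarith [wt_sq p w]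
  exact dist_eq_zero.1 (cosh_injOn dist_nonneg Set.self_mem_Ici h)

lemma lt_sqrt_one_add_sq (a b : ℝ) : b < √(1 + a ^ 2 + b ^ 2) :=
  lt_sqrt_of_sq_lt (by nlinarith [sq_nonneg a])

/-- The point with given Weierstrass coordinates based at `p`. -/
noncomputable def ofW (p : ℍ) (a b : ℝ) : ℍ :=
  -- The height is recovered from `wt p z - wy p z = p.im / z.im`.
  ⟨⟨p.re + a * (p.im / (√(1 + a ^ 2 + b ^ 2) - b)), p.im / (√(1 + a ^ 2 + b ^ 2) - b)⟩,
    div_pos p.im_pos (sub_pos.2 (lt_sqrt_one_add_sq a b))⟩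

lemma ofW_re (p : ℍ) (a b : ℝ) :
    (ofW p a b).re = p.re + a * (p.im / (√(1 + a ^ 2 + b ^ 2) - b)) := rfl

lemma ofW_im (p : ℍ) (a b : ℝ) : (ofW p a b).im = p.im / (√(1 + a ^ 2 + b ^ 2) - b) := rfl

lemma wx_ofW (p : ℍ) (a b : ℝ) : wx p (ofW p a b) = a := by
  have h := (ofW p a b).im_pos.ne'
  rw [wx, ofW_re, ← ofW_im]
  field_simp
  ring

lemma wy_ofW (p : ℍ) (a b : ℝ) : wy p (ofW p a b) = b := by
  have h := (sub_pos.2 (lt_sqrt_one_add_sq a b)).ne'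
  have hp := p.im_pos.ne'
  have hs : √(1 + a ^ 2 + b ^ 2) ^ 2 = 1 + a ^ 2 + b ^ 2 := sq_sqrt (by positivity)
  rw [wy, ofW_re, ofW_im]
  set e := √(1 + a ^ 2 + b ^ 2)
  field_simp
  linear_combination (-p.im ^ 2) * hs

lemma wt_ofW (p : ℍ) (a b : ℝ) : wt p (ofW p a b) = √(1 + a ^ 2 + b ^ 2) := by
  rw [← sqrt_sq (wt_pos p _).le, wt_sq, wx_ofW, wy_ofW]

/-- The point at signed distance `s` from `p` on the geodesic leaving `p` in direction `θ`. -/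
noncomputable def polar (p : ℍ) (θ s : ℝ) : ℍ := ofW p (sinh s * cos θ) (sinh s * sin θ)

lemma wx_polar (p : ℍ) (θ s : ℝ) : wx p (polar p θ s) = sinh s * cos θ := wx_ofW _ _ _

lemma wy_polar (p : ℍ) (θ s : ℝ) : wy p (polar p θ s) = sinh s * sin θ := wy_ofW _ _ _

lemma wt_polar (p : ℍ) (θ s : ℝ) : wt p (polar p θ s) = cosh s := by
  rw [polar, wt_ofW, ← sqrt_sq (cosh_pos s).le, cosh_sq]
  congr 1
  linear_combination sinh s ^ 2 * sin_sq_add_cos_sq θ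

lemma polar_zero (p : ℍ) (θ : ℝ) : polar p θ 0 = p :=
  eq_of_wx_eq_of_wy_eq (p := p) (by simp [wx_polar, wx_self]) (by simp [wy_polar, wy_self])

lemma cosh_dist_polar_polar (p : ℍ) (θ φ s t : ℝ) :
    cosh (dist (polar p θ s) (polar p φ t)) =
      cosh s * cosh t - sinh s * sinh t * cos (θ - φ) := by
  rw [cosh_dist_eq p]
  simp only [wx_polar, wy_polar, wt_polar, cos_sub]
  ring

lemma eq_abs_of_cosh_eq {x y : ℝ} (hx : 0 ≤ x) (h : cosh x = cosh y) : x = |y| :=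
  cosh_injOn hx (abs_nonneg y) (by rw [cosh_abs, h])

lemma dist_polar_polar (p : ℍ) (θ s t : ℝ) :
    dist (polar p θ s) (polar p θ t) = |s - t| := by
  refine eq_abs_of_cosh_eq dist_nonneg ?_
  rw [cosh_dist_polar_polar, sub_self, cos_zero, cosh_sub]
  ring

lemma dist_base_polar (p : ℍ) (θ s : ℝ) : dist p (polar p θ s) = |s| := by
  have := dist_polar_polar p θ 0 s
  rwa [polar_zero, zero_sub, abs_neg] at this

lemma exists_eq_polar (p z : ℍ) : ∃ θ, z = polar p θ (dist p z) := by
  have hs : sinh (dist p z) = ‖(⟨wx p z, wy p z⟩ : ℂ)‖ := by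
    rw [← sqrt_sq (sinh_nonneg_iff.2 dist_nonneg), sinh_sq, cosh_dist_base, wt_sq,
      Complex.norm_eq_sqrt_sq_add_sq]
    ring_nf
  refine ⟨Complex.arg ⟨wx p z, wy p z⟩, eq_of_wx_eq_of_wy_eq (p := p) ?_ ?_⟩
  · rw [wx_polar, hs, Complex.norm_mul_cos_arg]
  · rw [wy_polar, hs, Complex.norm_mul_sin_arg]

/-- Up to the factor `wt p z`, the hyperbolic tangent of the signed distance from `p` to the foot of
the perpendicular from `z` to the geodesic through `p` in direction `θ`. -/
noncomputable def along (p : ℍ) (θ : ℝ) (z : ℍ) : ℝ := wx p z * cos θ + wy p z * sin θ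

lemma along_polar (p : ℍ) (θ s : ℝ) : along p θ (polar p θ s) = sinh s := by
  rw [along, wx_polar, wy_polar]
  linear_combination sinh s * sin_sq_add_cos_sq θ

lemma along_self (p : ℍ) (θ : ℝ) : along p θ p = 0 := by simp [along, wx_self, wy_self]

lemma along_sq_add (p : ℍ) (θ : ℝ) (z : ℍ) :
    along p θ z ^ 2 + (wy p z * cos θ - wx p z * sin θ) ^ 2 + 1 = wt p z ^ 2 := by
  rw [wt_sq, along]
  linear_combination (wx p z ^ 2 + wy p z ^ 2) * sin_sq_add_cos_sq θ

lemma cosh_dist_polar (p : ℍ) (θ s : ℝ) (z : ℍ) :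
    cosh (dist (polar p θ s) z) = wt p z * cosh s - along p θ z * sinh s := by
  rw [cosh_dist_eq p, wt_polar, wx_polar, wy_polar, along]
  ring

lemma eq_polar_of_sub_eq_zero {p z : ℍ} {θ : ℝ} (h : wy p z * cos θ - wx p z * sin θ = 0) :
    z = polar p θ (arsinh (along p θ z)) := by
  refine eq_of_wx_eq_of_wy_eq (p := p) ?_ ?_
  · rw [wx_polar, sinh_arsinh, along]
    linear_combination (-sin θ) * h - wx p z * sin_sq_add_cos_sq θ
  · rw [wy_polar, sinh_arsinh, along]
    linear_combination cos θ * h - wy p z * sin_sq_add_cos_sq θ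

/-- Here `a` is the position of the foot of the perpendicular from `z` to the geodesic, and `k` is
the hyperbolic cosine of the length of that perpendicular. -/
lemma exists_wt_eq_along_eq (p : ℍ) (θ : ℝ) (z : ℍ) :
    ∃ k a : ℝ, 1 ≤ k ∧ wt p z = k * cosh a ∧ along p θ z = k * sinh a := by
  have h := along_sq_add p θ z
  have h1 : 1 ≤ wt p z ^ 2 - along p θ z ^ 2 := by
    nlinarith [sq_nonneg (wy p z * cos θ - wx p z * sin θ)]
  have hk : 1 ≤ √(wt p z ^ 2 - along p θ z ^ 2) := one_le_sqrt.2 h1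
  have hk2 : √(wt p z ^ 2 - along p θ z ^ 2) ^ 2 = wt p z ^ 2 - along p θ z ^ 2 :=
    sq_sqrt (by linarith)
  set k := √(wt p z ^ 2 - along p θ z ^ 2)
  have hk0 : k ≠ 0 := by positivity
  refine ⟨k, arsinh (along p θ z / k), hk, ?_, ?_⟩
  · refine (pow_left_inj₀ (wt_pos p z).le (by positivity) two_ne_zero).1 ?_
    rw [mul_pow, cosh_sq, sinh_arsinh]
    field_simp
    linarith
  · rw [sinh_arsinh]
    field_simp

/-- Projection to a geodesic does not increase the distance to points on it, so a ball centred there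
stays on one side of its perpendicular tangent. -/
lemma along_le_of_dist_le {p z : ℍ} {θ m M : ℝ} (hM : 0 ≤ M)
    (h : dist (polar p θ m) z ≤ M) :
    along p θ z * cosh (m + M) ≤ wt p z * sinh (m + M) := by
  obtain ⟨k, a, hk, ht, ha⟩ := exists_wt_eq_along_eq p θ z
  have h1 : cosh (dist (polar p θ m) z) ≤ cosh M := by
    rw [cosh_le_cosh, abs_of_nonneg dist_nonneg, abs_of_nonneg hM]
    exact h
  rw [cosh_dist_polar, ht, ha] at h1
  have h2 : cosh (a - m) ≤ cosh M := by
    have h3 : k * cosh (a - m) ≤ cosh M := by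
      rw [cosh_sub]
      linarith
    nlinarith [cosh_pos (a - m)]
  rw [cosh_le_cosh, abs_of_nonneg hM] at h2
  have h4 : a - (m + M) ≤ 0 := by linarith [le_abs_self (a - m)]
  have h5 := sinh_nonpos_iff.2 h4
  rw [sinh_sub] at h5
  rw [ht, ha]
  nlinarith

lemma along_nonneg_of_dist_le {p z : ℍ} {θ d : ℝ} (hd : 0 < d)
    (h : dist (polar p θ d) z ≤ d) : 0 ≤ along p θ z := by
  have h1 : cosh (dist (polar p θ d) z) ≤ cosh d := by
    rw [cosh_le_cosh, abs_of_nonneg dist_nonneg, abs_of_nonneg hd.le]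
    exact h
  rw [cosh_dist_polar] at h1
  have h2 := sinh_pos_iff.2 hd
  have h3 := one_le_wt p z
  have h4 : 0 ≤ along p θ z * sinh d := by nlinarith [cosh_pos d]
  exact nonneg_of_mul_nonneg_left h4 h2

lemma eq_polar_of_dist_eq {p z : ℍ} {θ m d : ℝ} (hd : 0 < d) (h1 : dist p z = m)
    (h2 : dist z (polar p θ d) = d - m) : z = polar p θ m := by
  have ht : wt p z = cosh m := by rw [← cosh_dist_base, h1]
  have ha : along p θ z = sinh m := by
    have h3 := cosh_dist_polar p θ d z
    rw [dist_comm, h2, cosh_sub, ht] at h3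
    have := sinh_pos_iff.2 hd
    have h5 : (along p θ z - sinh m) * sinh d = 0 := by linarith
    rcases mul_eq_zero.1 h5 with h | h
    · linarith
    · linarith
  have h6 := along_sq_add p θ z
  rw [ha, ht, cosh_sq] at h6
  have h7 : wy p z * cos θ - wx p z * sin θ = 0 := by
    refine pow_eq_zero_iff two_ne_zero |>.1 ?_
    linarith
  have h8 := eq_polar_of_sub_eq_zero h7
  rwa [ha, arsinh_sinh] at h8

/-! ### Geodesics as zero sets of linear forms -/

/-- The constant coefficient of the equation of a geodesic. -/
def Geodesic.c0 : Geodesic → ℝ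
  | .vertical a => -a
  | .semicircle a r _ => a ^ 2 - r ^ 2

/-- The coefficient of `re z` in the equation of a geodesic. -/
def Geodesic.c1 : Geodesic → ℝ
  | .vertical _ => 1
  | .semicircle a _ _ => -2 * a

/-- The coefficient of `|z| ^ 2` in the equation of a geodesic. -/
def Geodesic.c2 : Geodesic → ℝ
  | .vertical _ => 0
  | .semicircle _ _ _ => 1

/-- The defining function of a geodesic. -/
noncomputable def Geodesic.form (Γ : Geodesic) (z : ℍ) : ℝ :=
  Γ.c0 + Γ.c1 * z.re + Γ.c2 * (z.re ^ 2 + z.im ^ 2)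

lemma Geodesic.mem_carrier {Γ : Geodesic} {z : ℍ} : z ∈ Γ.carrier ↔ Γ.form z = 0 := by
  cases Γ with
  | vertical a =>
    simp only [carrier, form, c0, c1, c2, Set.mem_ofPred_eq]
    constructor <;> intro h <;> linarith
  | semicircle a r hr =>
    simp only [carrier, form, c0, c1, c2, Set.mem_ofPred_eq]
    rw [← pow_left_inj₀ (norm_nonneg _) hr.le two_ne_zero, ← Complex.normSq_eq_norm_sq,
      Complex.normSq_apply]
    simp only [Complex.sub_re, Complex.sub_im, Complex.ofReal_re, Complex.ofReal_im,
      UpperHalfPlane.coe_re, UpperHalfPlane.coe_im]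
    constructor <;> intro h <;> linarith

lemma Geodesic.disc_pos (Γ : Geodesic) : 0 < Γ.c1 ^ 2 - 4 * Γ.c0 * Γ.c2 := by
  cases Γ with
  | vertical a => simp [c0, c1, c2]
  | semicircle a r hr =>
    simp only [c0, c1, c2]
    nlinarith [sq_pos_of_pos hr]

lemma Geodesic.eq_of_coeff_eq {Γ Γ' : Geodesic} {k : ℝ} (h0 : Γ.c0 = k * Γ'.c0)
    (h1 : Γ.c1 = k * Γ'.c1) (h2 : Γ.c2 = k * Γ'.c2) : Γ = Γ' := by
  cases Γ with
  | vertical a =>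
    cases Γ' with
    | vertical b =>
      simp only [c0, c1] at *
      obtain rfl : k = 1 := by linarith
      congr 1
      linarith
    | semicircle b r hr =>
      simp only [c0, c1, c2] at *
      obtain rfl : k = 0 := by linarith
      simp at h1
  | semicircle a r hr =>
    cases Γ' with
    | vertical b => simp [c2] at h2
    | semicircle b s hs =>
      simp only [c0, c1, c2, mul_one] at *
      subst h2
      have hab : a = b := by linarith
      subst hab
      have hrs : r = s := (pow_left_inj₀ hr.le hs.le two_ne_zero).1 (by linarith)
      subst hrs
      rfl

/-- The time coefficient of the equation of a geodesic in Weierstrass coordinates. -/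
noncomputable def Geodesic.gt (Γ : Geodesic) (p : ℍ) : ℝ := Γ.form p / p.im

/-- The horizontal coefficient of the equation of a geodesic in Weierstrass coordinates. -/
noncomputable def Geodesic.gx (Γ : Geodesic) (p : ℍ) : ℝ := Γ.c1 + 2 * p.re * Γ.c2

/-- The vertical coefficient of the equation of a geodesic in Weierstrass coordinates. -/
noncomputable def Geodesic.gy (Γ : Geodesic) (p : ℍ) : ℝ := 2 * p.im * Γ.c2 - Γ.gt p

lemma Geodesic.form_eq (Γ : Geodesic) (p z : ℍ) :
    Γ.form z = z.im * (Γ.gt p * wt p z + Γ.gx p * wx p z + Γ.gy p * wy p z) := by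
  have := p.im_pos.ne'
  have := z.im_pos.ne'
  unfold gy gx gt form wt wx wy
  field_simp
  ring

lemma Geodesic.mem_carrier_iff (Γ : Geodesic) (p z : ℍ) :
    z ∈ Γ.carrier ↔ Γ.gt p * wt p z + Γ.gx p * wx p z + Γ.gy p * wy p z = 0 := by
  rw [mem_carrier, form_eq Γ p, mul_eq_zero, or_iff_right z.im_pos.ne']

lemma Geodesic.gt_eq_zero {Γ : Geodesic} {p : ℍ} (h : p ∈ Γ.carrier) : Γ.gt p = 0 := by
  rw [gt, mem_carrier.1 h, zero_div]

/-- The normal vector of a geodesic is spacelike, because its Minkowski square is the discriminant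
in `Geodesic.disc_pos`. Later this excludes vanishing coefficients. -/
lemma Geodesic.gt_sq_lt (Γ : Geodesic) (p : ℍ) : Γ.gt p ^ 2 < Γ.gx p ^ 2 + Γ.gy p ^ 2 := by
  have h := Γ.disc_pos
  have hp := p.im_pos.ne'
  have h1 : Γ.gx p ^ 2 + Γ.gy p ^ 2 - Γ.gt p ^ 2 = Γ.c1 ^ 2 - 4 * Γ.c0 * Γ.c2 := by
    unfold gy gx gt form
    field_simp
    ring
  linarith

lemma Geodesic.eq_of_proportional {Γ Γ' : Geodesic} (p : ℍ) {k : ℝ}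
    (ht : Γ.gt p = k * Γ'.gt p) (hx : Γ.gx p = k * Γ'.gx p) (hy : Γ.gy p = k * Γ'.gy p) :
    Γ = Γ' := by
  have hp := p.im_pos.ne'
  have h2 : Γ.c2 = k * Γ'.c2 := by
    unfold gy at hy
    refine mul_left_cancel₀ (mul_ne_zero two_ne_zero hp) ?_
    linarith
  have h1 : Γ.c1 = k * Γ'.c1 := by
    unfold gx at hx
    linear_combination hx - 2 * p.re * h2
  refine eq_of_coeff_eq ?_ h1 h2
  unfold gt form at ht
  field_simp at ht
  linear_combination ht - p.re * h1 - (p.re ^ 2 + p.im ^ 2) * h2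

lemma Geodesic.exists_tangent_eq (Γ : Geodesic) (z : ℍ) :
    ∃ k : ℝ, k ≠ 0 ∧ Complex.I * (Γ.c1 + 2 * Γ.c2 * z) = k * Γ.tangent z := by
  cases Γ with
  | vertical a => exact ⟨1, one_ne_zero, by simp [c1, c2, tangent]⟩
  | semicircle a r hr =>
    refine ⟨2, two_ne_zero, ?_⟩
    simp only [c1, c2, tangent]
    push_cast
    ring

/-- Up to scale, each tangent is the Euclidean gradient of the form turned by a right angle. On the
common zero set the inner product of the gradients is the Minkowski product of the normals. -/
lemma Geodesic.Perp.coeff {Γ Γ' : Geodesic} (h : Γ.Perp Γ') (p : ℍ) :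
    Γ.gx p * Γ'.gx p + Γ.gy p * Γ'.gy p - Γ.gt p * Γ'.gt p = 0 := by
  obtain ⟨z, hz, hz', hi⟩ := h
  obtain ⟨k, -, hk⟩ := Γ.exists_tangent_eq z
  obtain ⟨k', -, hk'⟩ := Γ'.exists_tangent_eq z
  have h1 : inner ℝ (Complex.I * (Γ.c1 + 2 * Γ.c2 * z)) (Complex.I * (Γ'.c1 + 2 * Γ'.c2 * z)) =
      (0 : ℝ) := by
    rw [hk, hk', ← Complex.real_smul, ← Complex.real_smul, real_inner_smul_left,
      real_inner_smul_right, hi]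
    simp
  rw [Complex.inner] at h1
  simp at h1
  have hp := p.im_pos.ne'
  rw [mem_carrier] at hz hz'
  have h2 : Γ.gx p * Γ'.gx p + Γ.gy p * Γ'.gy p - Γ.gt p * Γ'.gt p =
      Γ.c1 * Γ'.c1 - 2 * Γ.c0 * Γ'.c2 - 2 * Γ'.c0 * Γ.c2 := by
    unfold gy gx gt form
    field_simp
    ring
  rw [h2]
  unfold form at hz hz'
  linear_combination h1 - 2 * Γ'.c2 * hz - 2 * Γ.c2 * hz'

lemma exists_geodesic (p : ℍ) (θ : ℝ) :
    ∃ Γ : Geodesic, ∀ z, z ∈ Γ.carrier ↔ wy p z * cos θ - wx p z * sin θ = 0 := by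
  have hp := p.im_pos
  by_cases hθ : cos θ = 0
  · refine ⟨.vertical p.re, fun z => ?_⟩
    have hs : sin θ ≠ 0 := fun h => by simpa [hθ, h] using sin_sq_add_cos_sq θ
    rw [hθ, wx, Geodesic.carrier, Set.mem_ofPred_eq]
    simp [hs, z.im_pos.ne', sub_eq_zero]
  -- The centre is where the Euclidean normal to direction `θ` at `p` meets the real axis.
  · refine ⟨.semicircle (p.re + p.im * (sin θ / cos θ)) (p.im / |cos θ|)
      (div_pos hp (abs_pos.2 hθ)), fun z => ?_⟩
    have hz := z.im_pos
    have h1 : (wy p z * cos θ - wx p z * sin θ) * (2 * p.im * z.im) / cos θ =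
        Geodesic.form (.semicircle (p.re + p.im * (sin θ / cos θ)) (p.im / |cos θ|)
          (div_pos hp (abs_pos.2 hθ))) z := by
      simp only [Geodesic.form, Geodesic.c0, Geodesic.c1, Geodesic.c2, div_pow, sq_abs, wx, wy]
      field_simp
      linear_combination (- p.im ^ 2) * sin_sq_add_cos_sq θ
    rw [Geodesic.mem_carrier, ← h1]
    simp [hθ, hp.ne', hz.ne']

lemma polar_mem_of_forall_mem_iff {p : ℍ} {θ : ℝ} {Γ : Geodesic}
    (h : ∀ z, z ∈ Γ.carrier ↔ wy p z * cos θ - wx p z * sin θ = 0) (s : ℝ) :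
    polar p θ s ∈ Γ.carrier := by
  rw [h, wx_polar, wy_polar]
  ring

/-! ### Convexity -/

/-- The projective chart of the hyperbolic plane, in which geodesics are straight. -/
noncomputable def klein (z : ℍ) : ℝ × ℝ := (z.re, z.re ^ 2 + z.im ^ 2)

lemma continuous_klein : Continuous klein := by
  unfold klein
  have h1 := UpperHalfPlane.continuous_re
  have h2 := UpperHalfPlane.continuous_im
  fun_prop

lemma klein_injective : Function.Injective klein := by
  intro z w h
  simp only [klein, Prod.mk.injEq] at h
  obtain ⟨h1, h2⟩ := h
  refine UpperHalfPlane.ext (Complex.ext h1 ?_)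
  rw [h1] at h2
  exact (pow_left_inj₀ z.im_pos.le w.im_pos.le two_ne_zero).1 (by linarith)

/-- The inverse of the projective chart. -/
noncomputable def kleinInv (q : ℝ × ℝ) (h : q.1 ^ 2 < q.2) : ℍ :=
  ⟨⟨q.1, √(q.2 - q.1 ^ 2)⟩, sqrt_pos.2 (sub_pos.2 h)⟩

lemma klein_kleinInv (q : ℝ × ℝ) (h : q.1 ^ 2 < q.2) : klein (kleinInv q h) = q := by
  refine Prod.ext rfl ?_
  change q.1 ^ 2 + √(q.2 - q.1 ^ 2) ^ 2 = q.2
  rw [sq_sqrt (by linarith)]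
  ring

lemma klein_fst_sq_lt (z : ℍ) : (klein z).1 ^ 2 < (klein z).2 := by
  have := z.im_pos
  simp only [klein]
  nlinarith

lemma isOpen_klein_image {U : Set ℍ} (hU : IsOpen U) : IsOpen (klein '' U) := by
  have hV : IsOpen ((fun z : ℍ => (z : ℂ)) '' U) :=
    UpperHalfPlane.isOpenEmbedding_coe.isOpenMap U hU
  have hD : IsOpen {q : ℝ × ℝ | q.1 ^ 2 < q.2} := isOpen_lt (by fun_prop) (by fun_prop)
  have hg : Continuous fun q : ℝ × ℝ => (⟨q.1, √(q.2 - q.1 ^ 2)⟩ : ℂ) := by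
    have : (fun q : ℝ × ℝ => (⟨q.1, √(q.2 - q.1 ^ 2)⟩ : ℂ)) =
        fun q => ((q.1 : ℂ) + (√(q.2 - q.1 ^ 2) : ℂ) * Complex.I) := by
      ext q
      rw [Complex.mk_eq_add_mul_I]
    rw [this]
    fun_prop
  convert hD.inter (hV.preimage hg) using 1
  ext q
  constructor
  · rintro ⟨z, hz, rfl⟩
    refine ⟨klein_fst_sq_lt z, z, hz, ?_⟩
    refine Complex.ext rfl ?_
    change z.im = √(z.re ^ 2 + z.im ^ 2 - z.re ^ 2)
    rw [add_sub_cancel_left, sqrt_sq z.im_pos.le]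
  · rintro ⟨hq, z, hz, h⟩
    have : z = kleinInv q hq := UpperHalfPlane.ext h
    exact ⟨z, hz, by rw [this, klein_kleinInv]⟩

/-- The vector `(1, re, |z| ^ 2)` divided by the height gives linear coordinates on the hyperboloid.
There `z` is `A x + B y`, with the weights rescaled by heights; `hQ` is its normalization, and the
distances follow from Minkowski products. -/
lemma mem_seg_of_klein_eq {x y z : ℍ} {a b : ℝ} (ha : 0 ≤ a) (hb : 0 ≤ b) (hab : a + b = 1)
    (h : klein z = a • klein x + b • klein y) : z ∈ seg x y := by
  have hx := x.im_pos
  have hy := y.im_pos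
  have hz := z.im_pos
  simp only [klein, Prod.ext_iff, Prod.fst_add, Prod.snd_add, Prod.smul_fst, Prod.smul_snd,
    smul_eq_mul] at h
  obtain ⟨h1, h2⟩ := h
  have hd : z.im ^ 2 = a ^ 2 * x.im ^ 2 + b ^ 2 * y.im ^ 2 +
      a * b * ((x.re - y.re) ^ 2 + x.im ^ 2 + y.im ^ 2) := by
    have hb' : b = 1 - a := by linarith
    subst hb'
    rw [h1] at h2
    linear_combination h2
  have hc : cosh (dist x y) = ((x.re - y.re) ^ 2 + x.im ^ 2 + y.im ^ 2) / (2 * x.im * y.im) :=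
    UpperHalfPlane.cosh_dist' x y
  set c := cosh (dist x y)
  set A := a * x.im / z.im
  set B := b * y.im / z.im
  have hA : 0 ≤ A := by positivity
  have hB : 0 ≤ B := by positivity
  have hQ : A ^ 2 + B ^ 2 + 2 * A * B * c = 1 := by
    rw [hc]
    simp only [A, B]
    field_simp
    linarith
  have e1 : cosh (dist x z) = A + B * c := by
    rw [hc, UpperHalfPlane.cosh_dist']
    simp only [A, B]
    field_simp
    rw [show z.im ^ 2 = (a * x.re ^ 2 + a * x.im ^ 2 + b * y.re ^ 2 + b * y.im ^ 2) - z.re ^ 2 by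
      linarith, h1]
    have hb' : b = 1 - a := by linarith
    subst hb'
    ring
  have e2 : cosh (dist z y) = A * c + B := by
    rw [hc, UpperHalfPlane.cosh_dist']
    simp only [A, B]
    field_simp
    rw [show z.im ^ 2 = (a * x.re ^ 2 + a * x.im ^ 2 + b * y.re ^ 2 + b * y.im ^ 2) - z.re ^ 2 by
      linarith, h1]
    have hb' : b = 1 - a := by linarith
    subst hb'
    ring
  have hs : sinh (dist x y) ^ 2 = c ^ 2 - 1 := sinh_sq _
  have hs0 : 0 ≤ sinh (dist x y) := sinh_nonneg_iff.2 dist_nonneg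
  have s1 : sinh (dist x z) = B * sinh (dist x y) := by
    refine (pow_left_inj₀ (sinh_nonneg_iff.2 dist_nonneg) (by positivity) two_ne_zero).1 ?_
    rw [sinh_sq, e1, mul_pow, hs]
    linear_combination hQ
  have s2 : sinh (dist z y) = A * sinh (dist x y) := by
    refine (pow_left_inj₀ (sinh_nonneg_iff.2 dist_nonneg) (by positivity) two_ne_zero).1 ?_
    rw [sinh_sq, e2, mul_pow, hs]
    linear_combination hQ
  refine cosh_injOn (add_nonneg dist_nonneg dist_nonneg) (dist_nonneg (x := x) (y := y)) ?_
  rw [cosh_add, e1, e2, s1, s2]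
  linear_combination c * hQ + A * B * hs

lemma IsConvexBody.convex_klein {K : Set ℍ} (hK : IsConvexBody K) : Convex ℝ (klein '' K) := by
  rintro _ ⟨x, hx, rfl⟩ _ ⟨y, hy, rfl⟩ a b ha hb hab
  have hD : Convex ℝ {q : ℝ × ℝ | q.1 ^ 2 < q.2} := by
    rintro ⟨u, v⟩ hq ⟨u', v'⟩ hq' a b ha hb hab
    simp only [Set.mem_ofPred_eq, Prod.smul_mk, Prod.mk_add_mk, smul_eq_mul] at *
    rcases ha.eq_or_lt with rfl | ha'
    · obtain rfl : b = 1 := by linarith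
      simpa using hq'
    · have hb' : b = 1 - a := by linarith
      subst hb'
      nlinarith [mul_nonneg (mul_nonneg ha hb) (sq_nonneg (u - u')), mul_lt_mul_of_pos_left hq ha',
        mul_le_mul_of_nonneg_left hq'.le hb]
  have hq := hD (klein_fst_sq_lt x) (klein_fst_sq_lt y) ha hb hab
  refine ⟨kleinInv _ hq, hK.seg_subset x hx y hy ?_, klein_kleinInv _ hq⟩
  exact mem_seg_of_klein_eq ha hb hab (klein_kleinInv _ hq)

lemma Geodesic.continuous_form (Γ : Geodesic) : Continuous Γ.form := by
  unfold form
  have h1 := UpperHalfPlane.continuous_re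
  have h2 := UpperHalfPlane.continuous_im
  fun_prop

/-- A convex body lies on one side of each geodesic that misses its interior. -/
lemma IsConvexBody.form_nonneg_or_nonpos {K : Set ℍ} (hK : IsConvexBody K) {Γ : Geodesic}
    (h : Γ.carrier ∩ interior K = ∅) :
    (∀ z ∈ K, 0 ≤ Γ.form z) ∨ ∀ z ∈ K, Γ.form z ≤ 0 := by
  by_contra! hcon
  obtain ⟨⟨x, hx, hx0⟩, y, hy, hy0⟩ := hcon
  rw [← hK.closure_interior] at hx hy
  obtain ⟨x', hx0', hx'⟩ := mem_closure_iff.1 hx {z | Γ.form z < 0}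
    (isOpen_lt Γ.continuous_form continuous_const) hx0
  obtain ⟨y', hy0', hy'⟩ := mem_closure_iff.1 hy {z | 0 < Γ.form z}
    (isOpen_lt continuous_const Γ.continuous_form) hy0
  have hsub : klein '' interior K ⊆ interior (klein '' K) :=
    interior_maximal (Set.image_mono interior_subset) (isOpen_klein_image isOpen_interior)
  have hconv := hK.convex_klein.interior
  -- In the chart the form is the affine function `l`, which must vanish somewhere on the convex
  -- interior.
  let l : ℝ × ℝ → ℝ := fun q => Γ.c0 + Γ.c1 * q.1 + Γ.c2 * q.2
  have hl : Continuous l := by fun_prop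
  obtain ⟨q, hq, hq0⟩ := hconv.isPreconnected.intermediate_value (hsub ⟨x', hx', rfl⟩)
    (hsub ⟨y', hy', rfl⟩) hl.continuousOn ⟨le_of_lt hx0', le_of_lt hy0'⟩
  obtain ⟨z, -, rfl⟩ := interior_subset hq
  have hz : z ∈ interior K := by
    refine interior_maximal ?_ (isOpen_interior.preimage continuous_klein) hq
    intro w hw
    obtain ⟨w', hw', hww⟩ := interior_subset hw
    exact klein_injective hww ▸ hw'
  exact (Set.eq_empty_iff_forall_notMem.1 h z) ⟨Geodesic.mem_carrier.2 hq0, hz⟩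

/-! ### Smooth boundary points -/

/-- A form that is nonnegative on `K` and zero at `p` has a minimum along the boundary curve there,
so its gradient is orthogonal to the velocity. One `d` serves all such forms, which makes the
supporting direction unique. -/
lemma HasC1Boundary.exists_tangent {K : Set ℍ} (hK : IsClosed K) (h : HasC1Boundary K) {p : ℍ}
    (hp : p ∈ frontier K) :
    ∃ d : ℂ, d ≠ 0 ∧ ∀ a b : ℝ, (∀ z ∈ K, 0 ≤ a * wx p z + b * wy p z) →
      a * d.re + b * d.im = 0 := by
  obtain ⟨γ, hγ, hγ', -, hr⟩ := h
  obtain ⟨t, ht⟩ : (p : ℂ) ∈ Set.range γ := hr ▸ ⟨p, hp, rfl⟩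
  refine ⟨deriv γ t, hγ' t, fun a b hab => ?_⟩
  have hd : HasDerivAt γ (deriv γ t) t := (hγ.differentiable one_ne_zero t).hasDerivAt
  have hre : HasDerivAt (fun s => (γ s).re) (deriv γ t).re t :=
    Complex.reCLM.hasFDerivAt.comp_hasDerivAt t hd
  have him : HasDerivAt (fun s => (γ s).im) (deriv γ t).im t :=
    Complex.imCLM.hasFDerivAt.comp_hasDerivAt t hd
  have hp0 := p.im_pos
  let g : ℝ → ℝ := fun s => a * ((γ s).re - p.re) +
    b * ((((γ s).re - p.re) ^ 2 + (γ s).im ^ 2 - p.im ^ 2) / (2 * p.im))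
  have hg : HasDerivAt g (a * (deriv γ t).re + b * ((2 * ((γ t).re - p.re) ^ 1 * (deriv γ t).re +
      2 * (γ t).im ^ 1 * (deriv γ t).im) / (2 * p.im))) t := by
    exact ((hre.sub_const _).const_mul a).add
      (((((hre.sub_const _).pow 2).add (him.pow 2)).sub_const _).div_const _ |>.const_mul b)
  have hg0 : g t = 0 := by
    simp [g, ht]
  have hmin : IsLocalMin g t := by
    refine Filter.Eventually.of_forall fun s => ?_
    obtain ⟨z, hz, hzs⟩ : γ s ∈ (fun z : ℍ => (z : ℂ)) '' frontier K := hr ▸ ⟨s, rfl⟩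
    have h1 := hab z (hK.frontier_subset hz)
    have hz0 := z.im_pos
    have h2 : g s = z.im * (a * wx p z + b * wy p z) := by
      simp only [g, ← hzs, UpperHalfPlane.coe_re, UpperHalfPlane.coe_im, wx, wy]
      field_simp
    rw [hg0, h2]
    positivity
  have h0 := hmin.hasDerivAt_eq_zero hg
  rw [ht] at h0
  simp only [UpperHalfPlane.coe_re, UpperHalfPlane.coe_im, sub_self] at h0
  field_simp at h0
  refine mul_left_cancel₀ hp0.ne' ?_
  linarith

/-! ### Widths -/

/-- If `K` lies between the perpendiculars to a chord at its two end points, then the width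
of `K` at the first end point is the length of the chord. -/
lemma eq_of_width {K : Set ℍ} (hK : IsConvexBody K) {p y : ℍ} {θ d k : ℝ}
    (hp : p ∈ K) (hq : polar p θ d ∈ K) (h0 : ∀ z ∈ K, 0 ≤ along p θ z)
    (h1 : ∀ z ∈ K, along p θ z * cosh d ≤ wt p z * sinh d)
    {Γ₁ N Γ₂ : Geodesic} (hp1 : p ∈ Γ₁.carrier) (hx : Γ₁.gx p = k * cos θ)
    (hy : Γ₁.gy p = k * sin θ) (hpN : p ∈ N.carrier) (h1N : Γ₁.Perp N) (h2 : Supports Γ₂ K)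
    (hne : Γ₂ ≠ Γ₁) (h2N : Γ₂.Perp N) (hy2 : y ∈ Γ₂.carrier) (hyN : y ∈ N.carrier) :
    dist p y = d := by
  have hcs := sin_sq_add_cos_sq θ
  have hk : k ≠ 0 := by
    rintro rfl
    have := Γ₁.gt_sq_lt p
    rw [hx, hy, Geodesic.gt_eq_zero hp1] at this
    simp at this
  have hN0 := Geodesic.gt_eq_zero hpN
  obtain ⟨l, hNx, hNy⟩ : ∃ l, N.gx p = l * -sin θ ∧ N.gy p = l * cos θ := by
    have h := h1N.coeff p
    rw [hx, hy, hN0] at h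
    have h' : N.gx p * cos θ + N.gy p * sin θ = 0 := by
      refine mul_left_cancel₀ hk ?_
      linarith
    refine ⟨N.gy p * cos θ - N.gx p * sin θ, ?_, ?_⟩
    · linear_combination cos θ * h' - N.gx p * hcs
    · linear_combination sin θ * h' - N.gy p * hcs
  have hl : l ≠ 0 := by
    rintro rfl
    have := N.gt_sq_lt p
    rw [hNx, hNy, hN0] at this
    simp at this
  obtain ⟨s, rfl⟩ : ∃ s, y = polar p θ s := by
    rw [N.mem_carrier_iff p, hN0, hNx, hNy] at hyN
    refine ⟨_, eq_polar_of_sub_eq_zero (mul_left_cancel₀ hl ?_)⟩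
    linarith
  obtain ⟨j, h2x, h2y⟩ : ∃ j, Γ₂.gx p = j * cos θ ∧ Γ₂.gy p = j * sin θ := by
    have h := h2N.coeff p
    rw [hNx, hNy, hN0] at h
    have h' : Γ₂.gy p * cos θ - Γ₂.gx p * sin θ = 0 := by
      refine mul_left_cancel₀ hl ?_
      linarith
    refine ⟨Γ₂.gx p * cos θ + Γ₂.gy p * sin θ, ?_, ?_⟩
    · linear_combination -sin θ * h' - Γ₂.gx p * hcs
    · linear_combination cos θ * h' - Γ₂.gy p * hcs
  -- Up to scale, `Γ₂` is the perpendicular to the chord line at position `s`.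
  obtain ⟨κ, hj, h2t⟩ : ∃ κ, j = κ * cosh s ∧ Γ₂.gt p = -(κ * sinh s) := by
    have hs := (cosh_pos s).ne'
    rw [Γ₂.mem_carrier_iff p, wt_polar, wx_polar, wy_polar, h2x, h2y] at hy2
    refine ⟨j / cosh s, by field_simp, ?_⟩
    field_simp
    linear_combination hy2 - j * sinh s * hcs
  subst hj
  have hform : ∀ z, Γ₂.form z = κ * (z.im * (along p θ z * cosh s - wt p z * sinh s)) := by
    intro z
    rw [Γ₂.form_eq p, h2x, h2y, h2t, along]
    ring
  have hκ : κ ≠ 0 := by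
    rintro rfl
    have := Γ₂.gt_sq_lt p
    rw [h2x, h2y, h2t] at this
    simp at this
  obtain ⟨⟨z, hz2, hzK⟩, hint⟩ := h2
  rw [Geodesic.mem_carrier, hform, mul_eq_zero, or_iff_right hκ, mul_eq_zero,
    or_iff_right z.im_pos.ne'] at hz2
  have hz0 := h0 z hzK
  have hz1 := h1 z hzK
  have hzt := wt_pos p z
  -- The contact point `z` of `Γ₂` with `K` lies in the strip, which confines `s` to `[0, d]`.
  have hs0 : 0 ≤ s := by
    rw [← sinh_nonneg_iff]
    have : 0 ≤ wt p z * sinh s := by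
      rw [← sub_eq_zero.1 hz2]
      exact mul_nonneg hz0 (cosh_pos s).le
    exact nonneg_of_mul_nonneg_right this hzt
  have hsd : s ≤ d := by
    rw [← sub_nonpos, ← sinh_nonpos_iff, sinh_sub]
    have h3 : wt p z * (sinh s * cosh d - cosh s * sinh d) ≤ 0 := by
      have := mul_le_mul_of_nonneg_right hz1 (cosh_pos s).le
      linear_combination this - cosh d * hz2
    exact nonpos_of_mul_nonpos_right h3 hzt
  have hs0' : s ≠ 0 := by
    rintro rfl
    refine hne (Geodesic.eq_of_proportional p (k := κ / k) ?_ ?_ ?_)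
    · rw [h2t, Geodesic.gt_eq_zero hp1]
      simp
    · rw [h2x, hx, cosh_zero]
      field_simp
    · rw [h2y, hy, cosh_zero]
      field_simp
  -- For `0 < s < d`, the two ends of the chord would lie strictly on opposite sides of `Γ₂`.
  have hsd' : s = d := by
    by_contra hsd'
    have hlt : 0 < d - s := sub_pos.2 (lt_of_le_of_ne hsd hsd')
    have a1 : 0 < sinh s := sinh_pos_iff.2 (lt_of_le_of_ne hs0 hs0'.symm)
    have a2 : 0 < sinh (d - s) := sinh_pos_iff.2 hlt
    have fp : Γ₂.form p = -(κ * (p.im * sinh s)) := by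
      rw [hform, along_self, wt_self]
      ring
    have fq : Γ₂.form (polar p θ d) = κ * ((polar p θ d).im * sinh (d - s)) := by
      rw [hform, along_polar, wt_polar, sinh_sub]
    have b1 : 0 < p.im * sinh s := mul_pos p.im_pos a1
    have b2 : 0 < (polar p θ d).im * sinh (d - s) := mul_pos (UpperHalfPlane.im_pos _) a2
    rcases hK.form_nonneg_or_nonpos hint with h | h <;>
    · have e1 := h p hp
      have e2 := h _ hq
      rw [fp] at e1
      rw [fq] at e2
      rcases lt_or_gt_of_ne hκ with hκ' | hκ' <;> nlinarith
  rw [dist_base_polar, abs_of_nonneg hs0, hsd']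

lemma notMem_interior_of_along_nonneg {K : Set ℍ} {p : ℍ} {θ : ℝ}
    (h0 : ∀ z ∈ K, 0 ≤ along p θ z) : p ∉ interior K := by
  intro hp
  obtain ⟨ε, hε, h⟩ := Metric.mem_nhds_iff.1 (mem_interior_iff_mem_nhds.1 hp)
  have h1 : polar p θ (-(ε / 2)) ∈ Metric.ball p ε := by
    rw [Metric.mem_ball, dist_comm, dist_base_polar, abs_neg, abs_of_pos (by linarith)]
    linarith
  have h2 := h0 _ (h h1)
  rw [along_polar, sinh_nonneg_iff] at h2
  linarith

/-- The width of a smooth convex body of constant width is its diameter. -/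
lemma HasConstantWidth.dist_le {K : Set ℍ} {w : ℝ} (hK : IsConvexBody K) (hC1 : HasC1Boundary K)
    (hw : HasConstantWidth K w) (hw0 : 0 ≤ w) {x y : ℍ} (hx : x ∈ K) (hy : y ∈ K) :
    dist x y ≤ w := by
  obtain ⟨⟨p, q⟩, hpq, hmax⟩ := (hK.isCompact.prod hK.isCompact).exists_isMaxOn ⟨(x, y), hx, hy⟩
    (f := fun z : ℍ × ℍ => dist z.1 z.2) (by fun_prop)
  have hmax' : ∀ u ∈ K, ∀ v ∈ K, dist u v ≤ dist p q := fun u hu v hv =>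
    hmax (Set.mk_mem_prod hu hv)
  have hp : p ∈ K := hpq.1
  have hq : q ∈ K := hpq.2
  refine (hmax' x hx y hy).trans ?_
  obtain ⟨θ, hθ⟩ := exists_eq_polar p q
  set d := dist p q
  have hd0 : 0 ≤ d := dist_nonneg
  rcases hd0.eq_or_lt with hd | hd
  · rw [← hd]
    exact hw0
  have h0 : ∀ z ∈ K, 0 ≤ along p θ z := fun z hz =>
    along_nonneg_of_dist_le hd (by rw [← hθ]; exact hmax' q hq z hz)
  have h1 : ∀ z ∈ K, along p θ z * cosh d ≤ wt p z * sinh d := fun z hz => by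
    have := along_le_of_dist_le (z := z) (θ := θ) (m := 0) hd.le
      (by rw [polar_zero]; exact hmax' p hp z hz)
    rwa [zero_add] at this
  have hfr : p ∈ frontier K := by
    rw [hK.isCompact.isClosed.frontier_eq]
    exact ⟨hp, notMem_interior_of_along_nonneg h0⟩
  obtain ⟨Γ₁, N, Γ₂, y', hs1, hp1, hpN, h1N, hs2, hne, h2N, hy2, hyN, rfl⟩ := hw p hfr
  obtain ⟨e, he, hE⟩ := hC1.exists_tangent hK.isCompact.isClosed hfr
  -- The chord direction and the normal of `Γ₁` are both orthogonal to the boundary velocity, hence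
  -- parallel.
  have e1 : cos θ * e.re + sin θ * e.im = 0 := hE _ _ fun z hz => by
    have := h0 z hz
    rw [along] at this
    linarith
  have hform : ∀ z, Γ₁.form z = z.im * (Γ₁.gx p * wx p z + Γ₁.gy p * wy p z) := fun z => by
    rw [Γ₁.form_eq p, Geodesic.gt_eq_zero hp1]
    ring
  have e2 : Γ₁.gx p * e.re + Γ₁.gy p * e.im = 0 := by
    rcases hK.form_nonneg_or_nonpos hs1.2 with h | h
    · refine hE _ _ fun z hz => ?_
      have := h z hz
      rw [hform] at this
      exact nonneg_of_mul_nonneg_right this z.im_pos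
    · have : -Γ₁.gx p * e.re + -Γ₁.gy p * e.im = 0 := hE _ _ fun z hz => by
        have := h z hz
        rw [hform] at this
        have := nonpos_of_mul_nonpos_right this z.im_pos
        linarith
      linarith
  have hcs := sin_sq_add_cos_sq θ
  have e3 : Γ₁.gy p * cos θ - Γ₁.gx p * sin θ = 0 := by
    by_contra hne'
    refine he (Complex.ext ?_ ?_)
    · refine mul_left_cancel₀ hne' ?_
      rw [Complex.zero_re]
      linear_combination Γ₁.gy p * e1 - sin θ * e2
    · refine mul_left_cancel₀ hne' ?_
      rw [Complex.zero_im]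
      linear_combination cos θ * e2 - Γ₁.gx p * e1
  refine le_of_eq (eq_of_width hK hp (hθ ▸ hq) h0 h1 hp1
    (k := Γ₁.gx p * cos θ + Γ₁.gy p * sin θ) ?_ ?_ hpN h1N hs2 hne h2N hy2 hyN).symm
  · linear_combination -sin θ * e3 - Γ₁.gx p * hcs
  · linear_combination cos θ * e3 - Γ₁.gy p * hcs

/-- A geodesic that meets a sphere but not the open ball is perpendicular to the radius. -/
lemma Geodesic.gy_mul_cos_sub_eq_zero {Γ : Geodesic} {p : ℍ} {θ m : ℝ} (hm : 0 < m)
    (hp : p ∈ Γ.carrier) (h : ∀ z ∈ Γ.carrier, m ≤ dist (polar p θ m) z) :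
    Γ.gy p * cos θ - Γ.gx p * sin θ = 0 := by
  by_contra hne
  have h0 := Geodesic.gt_eq_zero hp
  have hpos := Γ.gt_sq_lt p
  have hmem : ∀ z, z ∈ Γ.carrier ↔ Γ.gx p * wx p z + Γ.gy p * wy p z = 0 := fun z => by
    rw [Γ.mem_carrier_iff p, h0, zero_mul, zero_add]
  rw [h0, zero_pow two_ne_zero] at hpos
  set a := Γ.gx p
  set b := Γ.gy p
  set κ := b * cos θ - a * sin θ with hκ
  -- Moving along `Γ` by a step proportional to `κ` brings the point closer to the centre at first
  -- order. This `ε` makes the bound for the second-order loss half of that gain.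
  set ε := sinh m / ((a ^ 2 + b ^ 2) * cosh m) with hε
  have hs := sinh_pos_iff.2 hm
  have hc := cosh_pos m
  have hε0 : 0 < ε := by positivity
  have hεm : ε * ((a ^ 2 + b ^ 2) * cosh m) = sinh m := by
    rw [hε]
    field_simp
  have hz := h (ofW p (ε * κ * b) (ε * κ * -a)) (by
    rw [hmem, wx_ofW, wy_ofW]
    ring)
  have h1 : cosh m ≤ cosh (dist (polar p θ m) (ofW p (ε * κ * b) (ε * κ * -a))) := by
    rw [cosh_le_cosh, abs_of_pos hm, abs_of_nonneg dist_nonneg]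
    exact hz
  rw [cosh_dist_polar, along, wx_ofW, wy_ofW, wt_ofW] at h1
  have h2 : √(1 + (ε * κ * b) ^ 2 + (ε * κ * -a) ^ 2) ≤
      1 + ε ^ 2 * κ ^ 2 * (a ^ 2 + b ^ 2) / 2 := by
    refine sqrt_le_iff.2 ⟨by positivity, ?_⟩
    nlinarith [sq_nonneg (ε ^ 2 * κ ^ 2 * (a ^ 2 + b ^ 2) / 2)]
  have h3 := mul_le_mul_of_nonneg_right h2 hc.le
  have h4 : 0 < ε * κ ^ 2 * sinh m := by positivity
  have h5 : (ε * κ * b * cos θ + ε * κ * -a * sin θ) * sinh m = ε * κ ^ 2 * sinh m := by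
    rw [hκ]
    ring
  rw [h5] at h1
  have h6 : ε ^ 2 * κ ^ 2 * (a ^ 2 + b ^ 2) / 2 * cosh m = ε * κ ^ 2 * sinh m / 2 := by
    linear_combination ε * κ ^ 2 / 2 * hεm
  linarith

/-! ### Equichordal points -/

/-- Signed positions record both ends of a chord by the single number `ρ`. -/
lemma exists_polar_mem_iff {O : ℍ} {K : Set ℍ} {c : ℝ}
    (hc : ∀ Γ : Geodesic, O ∈ Γ.carrier → HasLength (K ∩ Γ.carrier) c) (θ : ℝ) :
    ∃ ρ : ℝ, ∀ s, polar O θ s ∈ K ↔ ρ - c ≤ s ∧ s ≤ ρ := by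
  obtain ⟨Γ, hΓ⟩ := exists_geodesic O θ
  have hpol := polar_mem_of_forall_mem_iff hΓ
  obtain ⟨a, b, hab, hd⟩ := hc Γ (polar_zero O θ ▸ hpol 0)
  have ha : a ∈ K ∩ Γ.carrier := by
    rw [hab]
    simp [seg]
  have hb : b ∈ K ∩ Γ.carrier := by
    rw [hab]
    simp [seg]
  obtain ⟨s₁, rfl⟩ : ∃ s, a = polar O θ s := ⟨_, eq_polar_of_sub_eq_zero ((hΓ a).1 ha.2)⟩
  obtain ⟨s₂, rfl⟩ : ∃ s, b = polar O θ s := ⟨_, eq_polar_of_sub_eq_zero ((hΓ b).1 hb.2)⟩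
  have hmem : ∀ s, polar O θ s ∈ K ↔ |s₁ - s| + |s - s₂| = |s₁ - s₂| := fun s => by
    have h : polar O θ s ∈ K ↔ polar O θ s ∈ K ∩ Γ.carrier := by simp [hpol s]
    rw [h, hab, seg, Set.mem_ofPred_eq, dist_polar_polar, dist_polar_polar, dist_polar_polar]
  rw [dist_polar_polar] at hd
  refine ⟨max s₁ s₂, fun s => ?_⟩
  rw [hmem]
  grind

lemma pos_and_lt_of_mem_interior {O : ℍ} {K : Set ℍ} {c ρ θ : ℝ} (hO : O ∈ interior K)
    (hρ : ∀ s, polar O θ s ∈ K ↔ ρ - c ≤ s ∧ s ≤ ρ) : 0 < ρ ∧ ρ < c := by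
  obtain ⟨ε, hε, h⟩ := Metric.mem_nhds_iff.1 (mem_interior_iff_mem_nhds.1 hO)
  have key : ∀ s, |s| < ε → ρ - c ≤ s ∧ s ≤ ρ := fun s hs =>
    (hρ s).1 (h (by rwa [Metric.mem_ball, dist_comm, dist_base_polar]))
  have h1 := key (ε / 2) (by rw [abs_of_pos (by linarith)]; linarith)
  have h2 := key (-(ε / 2)) (by rw [abs_neg, abs_of_pos (by linarith)]; linarith)
  constructor <;> linarith

/-- For a convex body of constant width with an equichordal point, the width is the length of
the chords. -/
lemma HasConstantWidth.eq_of_equichordal {O : ℍ} {K : Set ℍ} {w c : ℝ} {ρ : ℝ → ℝ}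
    (hK : IsConvexBody K) (hO : O ∈ interior K) (hw : HasConstantWidth K w)
    (hρ : ∀ θ s, polar O θ s ∈ K ↔ ρ θ - c ≤ s ∧ s ≤ ρ θ) : w = c := by
  have hpos : ∀ θ, 0 < ρ θ := fun θ => (pos_and_lt_of_mem_interior hO (hρ θ)).1
  have hlt : ∀ θ, ρ θ < c := fun θ => (pos_and_lt_of_mem_interior hO (hρ θ)).2
  obtain ⟨q, hq, hmax⟩ := hK.isCompact.exists_isMaxOn ⟨O, interior_subset hO⟩
    (f := fun z : ℍ => dist O z) (by fun_prop)
  have hmax' : ∀ z ∈ K, dist O z ≤ dist O q := fun z hz => hmax hz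
  obtain ⟨θ₁, hθ₁⟩ := exists_eq_polar O q
  set M := dist O q with hM
  have hρM : ∀ θ, ρ θ ≤ M := fun θ => by
    have h := hmax' _ ((hρ θ (ρ θ)).2 ⟨by linarith [hpos θ, hlt θ], le_rfl⟩)
    rwa [dist_base_polar, abs_of_pos (hpos θ)] at h
  have hMρ : M = ρ θ₁ := le_antisymm ((hρ θ₁ M).1 (hθ₁ ▸ hq)).2 (hρM θ₁)
  have hM0 : 0 < M := hMρ ▸ hpos θ₁
  have hMc : M < c := hMρ ▸ hlt θ₁
  -- The opposite end of the chord is at distance `c - ρ θ` from `O`, and this is at most `M`.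
  have hcM : ∀ θ, c - M ≤ ρ θ := fun θ => by
    have h := hmax' _ ((hρ θ (ρ θ - c)).2 ⟨le_rfl, by linarith [hpos θ, hlt θ]⟩)
    rw [dist_base_polar, abs_of_neg (by linarith [hlt θ])] at h
    linarith
  obtain ⟨p, hpdef⟩ : ∃ p, p = polar O θ₁ (M - c) := ⟨_, rfl⟩
  have hp : p ∈ K := by
    rw [hpdef, hρ, ← hMρ]
    constructor <;> linarith
  have hpO : dist p O = c - M := by
    rw [dist_comm, hpdef, dist_base_polar, abs_of_neg (by linarith)]
    ring
  have hpq : dist p q = c := by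
    rw [hpdef, hθ₁, dist_polar_polar, abs_of_neg (by linarith)]
    ring
  obtain ⟨θ, hθ⟩ := exists_eq_polar p q
  rw [hpq] at hθ
  have hc : 0 < c := hM0.trans hMc
  have hOp : O = polar p θ (c - M) := by
    refine eq_polar_of_dist_eq hc hpO ?_
    rw [← hθ, ← hM]
    ring
  have hball : Metric.ball O (c - M) ⊆ interior K := by
    refine interior_maximal (fun z hz => ?_) Metric.isOpen_ball
    rw [Metric.mem_ball, dist_comm] at hz
    obtain ⟨φ, hφ⟩ := exists_eq_polar O z
    rw [hφ, hρ]
    have h0 : 0 ≤ dist O z := dist_nonneg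
    constructor <;> linarith [hcM φ, hρM φ]
  have hfr : p ∈ frontier K := by
    rw [hK.isCompact.isClosed.frontier_eq]
    refine ⟨hp, fun hpi => ?_⟩
    obtain ⟨ε, hε, h⟩ := Metric.mem_nhds_iff.1 (mem_interior_iff_mem_nhds.1 hpi)
    have h1 : polar O θ₁ (M - c - ε / 2) ∈ Metric.ball p ε := by
      rw [Metric.mem_ball, hpdef, dist_polar_polar, abs_of_neg (by linarith)]
      linarith
    have h2 := ((hρ _ _).1 (h h1)).1
    linarith
  obtain ⟨Γ₁, N, Γ₂, y, hs1, hp1, hpN, h1N, hs2, hne, h2N, hy2, hyN, rfl⟩ := hw p hfr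
  have hcs := sin_sq_add_cos_sq θ
  have e3 : Γ₁.gy p * cos θ - Γ₁.gx p * sin θ = 0 := by
    refine Geodesic.gy_mul_cos_sub_eq_zero (sub_pos.2 hMc) hp1 fun z hz => ?_
    rw [← hOp]
    by_contra! hlt'
    exact (Set.eq_empty_iff_forall_notMem.1 hs1.2 z)
      ⟨hz, hball (by rwa [Metric.mem_ball, dist_comm])⟩
  obtain ⟨k, hkx, hky⟩ : ∃ k, Γ₁.gx p = k * cos θ ∧ Γ₁.gy p = k * sin θ := by
    refine ⟨Γ₁.gx p * cos θ + Γ₁.gy p * sin θ, ?_, ?_⟩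
    · linear_combination -sin θ * e3 - Γ₁.gx p * hcs
    · linear_combination cos θ * e3 - Γ₁.gy p * hcs
  have hk : k ≠ 0 := by
    rintro rfl
    have := Γ₁.gt_sq_lt p
    rw [hkx, hky, Geodesic.gt_eq_zero hp1] at this
    simp at this
  have hform : ∀ z, Γ₁.form z = z.im * (k * along p θ z) := fun z => by
    rw [Γ₁.form_eq p, Geodesic.gt_eq_zero hp1, hkx, hky, along]
    ring
  have hsc := sinh_pos_iff.2 hc
  -- The position of `q` decides on which side of `Γ₁` the body lies.
  have h0 : ∀ z ∈ K, 0 ≤ along p θ z := by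
    rcases hK.form_nonneg_or_nonpos hs1.2 with h | h
    · have hkq := h q hq
      rw [hform, hθ, along_polar] at hkq
      have hk0 := nonneg_of_mul_nonneg_left
        (nonneg_of_mul_nonneg_right hkq (UpperHalfPlane.im_pos _)) hsc
      intro z hz
      have hkz := h z hz
      rw [hform] at hkz
      exact nonneg_of_mul_nonneg_right (nonneg_of_mul_nonneg_right hkz z.im_pos)
        (lt_of_le_of_ne hk0 hk.symm)
    · have hkq := h q hq
      rw [hform, hθ, along_polar] at hkq
      have hk0 := nonpos_of_mul_nonpos_left
        (nonpos_of_mul_nonpos_right hkq (UpperHalfPlane.im_pos _)) hsc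
      intro z hz
      have hkz := h z hz
      rw [hform] at hkz
      have hkz' := nonpos_of_mul_nonpos_right hkz z.im_pos
      have hk1 : k < 0 := lt_of_le_of_ne hk0 hk
      by_contra! hneg
      linarith [mul_pos_of_neg_of_neg hk1 hneg]
  have h1 : ∀ z ∈ K, along p θ z * cosh c ≤ wt p z * sinh c := fun z hz => by
    have := along_le_of_dist_le (z := z) (θ := θ) (m := c - M) hM0.le
      (by rw [← hOp]; exact hmax' z hz)
    rwa [sub_add_cancel] at this
  exact eq_of_width hK hp (hθ ▸ hq) h0 h1 hp1 hkx hky hpN h1N hs2 hne h2N hy2 hyN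

/-- If the two pieces `x` and `c - y` were aligned, their total length would exceed `c` by `x - y`,
raising the cosh by at least `sinh c * (x - y)`. Bending by `δ` recovers only a quadratic amount. -/
lemma sub_le_of_cosh_le {x y c δ : ℝ} (hx : 0 < x) (hxc : x < c) (hy : 0 < y) (hyc : y < c)
    (h : cosh x * cosh (y - c) - sinh x * sinh (y - c) * cos δ ≤ cosh c) :
    x - y ≤ sinh c / 2 * δ ^ 2 := by
  have hc : 0 < sinh c := sinh_pos_iff.2 (hx.trans hxc)
  rcases le_total (x - y) 0 with h0 | h0
  · exact h0.trans (by positivity)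
  rw [← neg_sub c y, cosh_neg, sinh_neg] at h
  have h1 : cosh c + sinh c * (x - y) ≤ cosh (x + (c - y)) := by
    rw [show x + (c - y) = c + (x - y) by ring, cosh_add]
    have h2 := one_le_cosh (x - y)
    have h3 := self_le_sinh_iff.2 h0
    nlinarith [cosh_pos c]
  rw [cosh_add] at h1
  have h4 : sinh x * sinh (c - y) ≤ sinh c * sinh c :=
    mul_le_mul (sinh_le_sinh.2 hxc.le) (sinh_le_sinh.2 (by linarith))
      (sinh_nonneg_iff.2 (by linarith)) hc.le
  have h5 : 1 - cos δ ≤ δ ^ 2 / 2 := by linarith [one_sub_sq_div_two_le_cos (x := δ)]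
  have h6 : 0 ≤ 1 - cos δ := by linarith [cos_le_one δ]
  have h7 : sinh x * sinh (c - y) * (1 - cos δ) ≤ sinh c * sinh c * (δ ^ 2 / 2) :=
    mul_le_mul h4 h5 h6 (by positivity)
  refine le_of_mul_le_mul_left ?_ hc
  linarith

lemma eq_of_forall_sub_le_mul_sq {f : ℝ → ℝ} {C : ℝ}
    (h : ∀ x y, f x - f y ≤ C * (x - y) ^ 2) (x y : ℝ) : f x = f y := by
  have hd : ∀ x, HasDerivAt f 0 x := fun x => by
    rw [hasDerivAt_iff_isLittleO]
    refine Asymptotics.IsBigO.trans_isLittleO ?_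
      (Asymptotics.isLittleO_pow_sub_sub x one_lt_two)
    refine Asymptotics.IsBigO.of_bound C (Filter.Eventually.of_forall fun z => ?_)
    rw [smul_zero, sub_zero, norm_pow, norm_norm, norm_eq_abs, norm_eq_abs, sq_abs, abs_le]
    have h1 := h z x
    have h2 := h x z
    constructor <;> linarith
  exact is_const_of_deriv_eq_zero (fun x => (hd x).differentiableAt) (fun x => (hd x).deriv) x y

end HypPlane

theorem mainTheorem4 (O : UpperHalfPlane) (K : Set UpperHalfPlane) (w c : ℝ)
    (hK : HypPlane.IsConvexBody K)
    (hO : O ∈ interior K)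
    (hC1 : HypPlane.HasC1Boundary K)
    (hw : HypPlane.HasConstantWidth K w)
    (hc : ∀ Γ : HypPlane.Geodesic, O ∈ Γ.carrier → HypPlane.HasLength (K ∩ Γ.carrier) c) :
    HypPlane.IsDisc K := by
  choose ρ hρ using HypPlane.exists_polar_mem_iff hc
  have hpos : ∀ θ, 0 < ρ θ := fun θ => (HypPlane.pos_and_lt_of_mem_interior hO (hρ θ)).1
  have hlt : ∀ θ, ρ θ < c := fun θ => (HypPlane.pos_and_lt_of_mem_interior hO (hρ θ)).2
  have hc0 : 0 < c := (hpos 0).trans (hlt 0)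
  obtain rfl : w = c := hw.eq_of_equichordal hK hO hρ
  have hconst : ∀ θ φ, ρ θ = ρ φ :=
    HypPlane.eq_of_forall_sub_le_mul_sq (C := Real.sinh w / 2) fun θ φ => by
      refine HypPlane.sub_le_of_cosh_le (hpos θ) (hlt θ) (hpos φ) (hlt φ) ?_
      rw [← HypPlane.cosh_dist_polar_polar O, Real.cosh_le_cosh, abs_of_nonneg dist_nonneg,
        abs_of_pos hc0]
      exact hw.dist_le hK hC1 hc0.le
        ((hρ _ _).2 ⟨by linarith [hpos θ, hlt θ], le_rfl⟩)
        ((hρ _ _).2 ⟨le_rfl, by linarith [hpos φ, hlt φ]⟩)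
  refine ⟨O, ρ 0, hpos 0, ?_⟩
  ext z
  obtain ⟨θ, hθ⟩ := HypPlane.exists_eq_polar O z
  rw [Metric.mem_closedBall, dist_comm z O]
  have h0 : 0 ≤ dist O z := dist_nonneg
  rw [← hconst θ 0]
  nth_rw 1 [hθ]
  rw [hρ]
  -- The lower end of the chord is no constraint, since `ρ θ - w` is negative.
  exact ⟨fun h => h.2, fun h => ⟨by linarith [hlt θ], h⟩⟩
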